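/- Let $\mathcal X,\mathcal Y$ be finite sets with at least two elements each, and let $P_{X,Y}$ be a joint pmf on $\mathcal X\times\mathcal Y$ whose marginals satisfy $P_X(x)>0$ for all $x\in\mathcal X$ and $P_Y(y)>0$ for all $y\in\mathcal Y$. For an input pmf $P$ on a finite set and a channel with column stochastic transition matrix $W$, define the contraction coefficients $$\eta_{\mathrm{KL}}(P,W)=\sup_{R:\,0<D(R\|P)<\infty}\frac{D(WR\|WP)}{D(R\|P)},\qquad \eta_{\chi^2}(P,W)=\sup_{R:\,0<\chi^2(R\|P)<\infty}\frac{\chi^2(WR\|WP)}{\chi^2(R\|P)},$$ where $R$ ranges over pmfs on the input alphabet, $D(R\|P)=\sum_x R(x)\log\frac{R(x)}{P(x)}$ (natural logarithm), $\chi^2(R\|P)=\sum_x\frac{(R(x)-P(x))^2}{P(x)}$, both divergences are $+\infty$ if $R(x)>0=P(x)$ for some $x$, and a supremum over the empty set is $0$. If $(X_1,Y_1),\dots,(X_n,Y_n)$ are i.i.d. with joint pmf $P_{X,Y}$, then $$\eta_{\chi^2}\!\left(P_{X_1^n},P_{Y_1^n|X_1^n}\right)\le \eta_{\mathrm{KL}}\!\left(P_{X_1^n},P_{Y_1^n|X_1^n}\right)\le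 \frac{2\,\eta_{\chi^2}\!\left(P_{X_1^n},P_{Y_1^n|X_1^n}\right)}{\phi\!\left(\max_{A\subseteq\mathcal X}\pi(A)\right)\,\min_{x\in\mathcal X}P_X(x)},$$ where $X_1^n=(X_1,\dots,X_n)$, $Y_1^n=(Y_1,\dots,Y_n)$, $\pi(A)=\min\{P_X(A),1-P_X(A)\}$, and $\phi(p)=\frac{1}{1-2p}\log\frac{1-p}{p}$ for $0<p<\frac12$, $\phi(\tfrac12)=2$. -/

import Mathlib

open scoped ENNReal

noncomputable section

namespace SDPI

/-- Kullback-Leibler divergence `D(R‖P)` (natural logarithm) of pmfs on a finite set. The summand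
at a point with `R x = 0` is `0`, and `D(R‖P) = ∞` if `R x > 0 = P x` for some `x`. For pmfs the
real sum is nonnegative (Gibbs), so `ENNReal.ofReal` only embeds it in `[0, ∞]`. -/
def klDiv {α : Type*} [Fintype α] (R P : α → ℝ) : ℝ≥0∞ :=
  open Classical in
  if ∀ x, P x = 0 → R x = 0 then ENNReal.ofReal (∑ x, R x * Real.log (R x / P x)) else ⊤

/-- `χ²`-divergence `χ²(R‖P)` of pmfs on a finite set, equal to `∞` if `R x > 0 = P x` for
some `x`; points with `R x = P x = 0` contribute `0`. -/
def chiSqDiv {α : Type*} [Fintype α] (R P : α → ℝ) : ℝ≥0∞ :=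
  open Classical in
  if ∀ x, P x = 0 → R x = 0 then ENNReal.ofReal (∑ x, (R x - P x) ^ 2 / P x) else ⊤

/-- Contraction coefficient for KL divergence of an input pmf `P` and a channel given by its
column stochastic matrix `W`. The supremum is taken in `[0, ∞]`, so it is `0` over the empty
family; hence the value is `0` when the input or the output is almost surely constant. -/
def etaKL {α β : Type*} [Fintype α] [Fintype β] (P : α → ℝ) (W : Matrix β α ℝ) : ℝ≥0∞ :=
  ⨆ R ∈ {R : α → ℝ | R ∈ stdSimplex ℝ α ∧ 0 < klDiv R P ∧ klDiv R P < ⊤},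
    klDiv (W.mulVec R) (W.mulVec P) / klDiv R P

/-- Contraction coefficient for `χ²`-divergence, with the same conventions. -/
def etaChiSq {α β : Type*} [Fintype α] [Fintype β] (P : α → ℝ) (W : Matrix β α ℝ) : ℝ≥0∞ :=
  ⨆ R ∈ {R : α → ℝ | R ∈ stdSimplex ℝ α ∧ 0 < chiSqDiv R P ∧ chiSqDiv R P < ⊤},
    chiSqDiv (W.mulVec R) (W.mulVec P) / chiSqDiv R P

/-- First marginal of a joint pmf. -/
def fstMarginal {α β : Type*} [Fintype β] (Q : α × β → ℝ) : α → ℝ :=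
  fun x => ∑ y, Q (x, y)

/-- Second marginal of a joint pmf. -/
def sndMarginal {α β : Type*} [Fintype α] (Q : α × β → ℝ) : β → ℝ :=
  fun y => ∑ x, Q (x, y)

/-- Transition matrix of the conditional pmfs of the second coordinate given the first:
the entry in row `y` and column `x` is `Q (x, y) / Q_X x`. -/
def channel {α β : Type*} [Fintype β] (Q : α × β → ℝ) : Matrix β α ℝ :=
  Matrix.of fun y x => Q (x, y) / fstMarginal Q x

/-- The pmf of a discrete random variable `Z` on the probability space `(Ω, μ)`. -/
def pmfOf {Ω γ : Type*} [MeasurableSpace Ω] (μ : MeasureTheory.Measure Ω) (Z : Ω → γ) : γ → ℝ :=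
  fun z => μ.real (Z ⁻¹' {z})

/-- The function `φ` of the distribution dependent Pinsker inequality, used on `(0, 1/2]`. -/
def phi (p : ℝ) : ℝ :=
  if p = 1 / 2 then 2 else 1 / (1 - 2 * p) * Real.log ((1 - p) / p)

/-- `max_A min {P(A), 1 - P(A)}` over all subsets `A` of the alphabet. -/
def maxBalance {α : Type*} [Fintype α] (P : α → ℝ) : ℝ :=
  Finset.univ.sup' Finset.univ_nonempty
    fun A : Finset α => min (∑ x ∈ A, P x) (1 - ∑ x ∈ A, P x)

/-- The smallest probability `min_x P(x)`. -/
def minProb {α : Type*} [Fintype α] [Nonempty α] (P : α → ℝ) : ℝ :=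
  Finset.univ.inf' Finset.univ_nonempty P

end SDPI

end

namespace SDPI

/-! The lower bound is local: moving from `P` towards `R` by `ε`, KL divergence is `ε ^ 2 / 2` times
`χ²` to leading order, at the input and at the output alike, so every `χ²` ratio is a limit of KL
ratios (`etaChiSq_le_etaKL`).

The upper bound comes from one letter, so its constant does not depend on `n`. For one letter,
`D(WR‖WP) ≤ χ²(WR‖WP) ≤ η χ²(R‖P) ≤ η * 2 * tv ^ 2 / min P`, with `η` the `χ²` coefficient, and a
Pinsker inequality with constant `φ` bounds `tv ^ 2` by `D(R‖P) / φ` (`contracts_of_chiSq`). The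
resulting contraction constant passes to products by the chain rule and convexity of divergence
(`Contracts.prod`). Finally, `η` for one letter is at most its value for `n + 1` letters
(`etaChiSq_le_pi_succ`); equality is not needed. -/

/-- The log-sum inequality. -/
theorem log_sum_inequality {ι : Type*} (s : Finset ι) (a b : ι → ℝ) (ha : ∀ i ∈ s, 0 ≤ a i)
    (hb : ∀ i ∈ s, 0 ≤ b i) (hab : ∀ i ∈ s, b i = 0 → a i = 0) :
    (∑ i ∈ s, a i) * Real.log ((∑ i ∈ s, a i) / ∑ i ∈ s, b i) ≤
      ∑ i ∈ s, a i * Real.log (a i / b i) := by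
  rcases (Finset.sum_nonneg ha).eq_or_lt with hA | hA
  · rw [← hA, zero_mul]
    have h := (Finset.sum_eq_zero_iff_of_nonneg ha).1 hA.symm
    exact (Finset.sum_eq_zero fun i hi => by rw [h i hi, zero_mul]).ge
  set A := ∑ i ∈ s, a i with hAdef
  set B := ∑ i ∈ s, b i with hBdef
  have hB : 0 < B := by
    rcases (Finset.sum_nonneg hb).eq_or_lt with h | h
    · have h' := (Finset.sum_eq_zero_iff_of_nonneg hb).1 h.symm
      exact absurd (Finset.sum_eq_zero fun i hi => hab i hi (h' i hi)) hA.ne'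
    · exact h
  have key : ∀ i ∈ s, a i * Real.log (A / B) + (a i - b i * (A / B)) ≤
      a i * Real.log (a i / b i) := by
    intro i hi
    rcases (ha i hi).eq_or_lt with h | h
    · rw [← h]
      have := mul_nonneg (hb i hi) (div_pos hA hB).le
      linarith
    · have hbi : 0 < b i := (hb i hi).lt_of_ne fun h' => h.ne' (hab i hi h'.symm)
      have h1 := Real.one_sub_inv_le_log_of_pos (div_pos (div_pos h hbi) (div_pos hA hB))
      rw [Real.log_div (div_pos h hbi).ne' (div_pos hA hB).ne'] at h1
      have h2 := mul_le_mul_of_nonneg_left h1 h.le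
      have h3 : a i * (1 - (a i / b i / (A / B))⁻¹) = a i - b i * (A / B) := by
        field_simp
      linarith
  have := Finset.sum_le_sum key
  rw [Finset.sum_add_distrib, Finset.sum_sub_distrib, ← Finset.sum_mul, ← Finset.sum_mul,
    ← hAdef, ← hBdef, mul_div_cancel₀ _ hB.ne'] at this
  linarith

/-! ### Homogeneous divergence and tensorization of contraction -/

/-- The degree one homogeneous extension of the divergence `D(R‖P)` to nonnegative vectors. -/
noncomputable def ent {α : Type*} [Fintype α] (R P : α → ℝ) : ℝ :=
  ∑ x, R x * Real.log (R x / P x) - (∑ x, R x) * Real.log (∑ x, R x)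

section Entropy

variable {α β γ δ : Type*} [Fintype α] [Fintype β] [Fintype γ] [Fintype δ]

theorem ent_smul {P : α → ℝ} (hP : ∀ x, 0 < P x) (R : α → ℝ) (t : ℝ) :
    ent (fun x => t * R x) P = t * ent R P := by
  rcases eq_or_ne t 0 with rfl | ht
  · simp [ent]
  have h1 : ∀ x, t * R x * Real.log (t * R x / P x) =
      t * (R x * Real.log (R x / P x)) + t * Real.log t * R x := by
    intro x
    rcases eq_or_ne (R x) 0 with h | h
    · simp [h]
    · rw [mul_div_assoc, Real.log_mul ht (div_ne_zero h (hP x).ne')]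
      ring
  have h2 : (t * ∑ x, R x) * Real.log (t * ∑ x, R x) =
      t * ((∑ x, R x) * Real.log (∑ x, R x)) + t * Real.log t * ∑ x, R x := by
    rcases eq_or_ne (∑ x, R x) 0 with h | h
    · simp [h]
    · rw [Real.log_mul ht h]
      ring
  unfold ent
  rw [← Finset.mul_sum, h2, Finset.sum_congr rfl fun x _ => h1 x, Finset.sum_add_distrib,
    ← Finset.mul_sum, ← Finset.mul_sum]
  ring

/-- Absorbing the total mass into the reference makes subadditivity a pointwise log-sum inequality.
-/
theorem ent_eq_sum {P : α → ℝ} (hP : ∀ x, 0 < P x) {R : α → ℝ} (hR : ∀ x, 0 ≤ R x) :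
    ent R P = ∑ x, R x * Real.log (R x / ((∑ x, R x) * P x)) := by
  unfold ent
  rw [Finset.sum_mul, ← Finset.sum_sub_distrib]
  refine Finset.sum_congr rfl fun x _ => ?_
  rcases (hR x).eq_or_lt with h | h
  · simp [← h]
  · have hm : 0 < ∑ x, R x :=
      h.trans_le (Finset.single_le_sum (fun i _ => hR i) (Finset.mem_univ x))
    rw [Real.log_div h.ne' (hP x).ne', Real.log_div h.ne' (mul_pos hm (hP x)).ne',
      Real.log_mul hm.ne' (hP x).ne']
    ring

theorem ent_sum_le {ι : Type*} [Fintype ι] {P : α → ℝ} (hP : ∀ x, 0 < P x) (R : ι → α → ℝ)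
    (hR : ∀ i x, 0 ≤ R i x) : ent (fun x => ∑ i, R i x) P ≤ ∑ i, ent (R i) P := by
  rw [ent_eq_sum hP fun x => Finset.sum_nonneg fun i _ => hR i x,
    Finset.sum_congr rfl fun i _ => ent_eq_sum hP (hR i)]
  have hm : ∑ x, ∑ i, R i x = ∑ i, ∑ x, R i x := Finset.sum_comm
  have hr : ∑ i, ∑ x, R i x * Real.log (R i x / ((∑ x, R i x) * P x)) =
      ∑ x, ∑ i, R i x * Real.log (R i x / ((∑ x, R i x) * P x)) := Finset.sum_comm
  rw [hm, hr]
  refine Finset.sum_le_sum fun x _ => ?_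
  rw [Finset.sum_mul Finset.univ (fun i => ∑ x, R i x) (P x)]
  refine log_sum_inequality Finset.univ (fun i => R i x) (fun i => (∑ x, R i x) * P x)
    (fun i _ => hR i x)
    (fun i _ => mul_nonneg (Finset.sum_nonneg fun x _ => hR i x) (hP x).le) fun i _ h => ?_
  rcases mul_eq_zero.1 h with h | h
  · exact (Finset.sum_eq_zero_iff_of_nonneg fun x _ => hR i x).1 h x (Finset.mem_univ x)
  · exact absurd h (hP x).ne'

/-- Chain rule for a product reference measure. -/
theorem ent_prod {P₁ : α → ℝ} {P₂ : γ → ℝ} (hP₁ : ∀ x, 0 < P₁ x) (hP₂ : ∀ x, 0 < P₂ x)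
    {R : α × γ → ℝ} (hR : ∀ x, 0 ≤ R x) :
    ent R (fun x => P₁ x.1 * P₂ x.2) =
      ent (fun x => ∑ z, R (x, z)) P₁ + ∑ x, ent (fun z => R (x, z)) P₂ := by
  unfold ent
  rw [Fintype.sum_prod_type, Fintype.sum_prod_type, Finset.sum_sub_distrib]
  have h : ∀ x, ∑ z, R (x, z) * Real.log (R (x, z) / (P₁ x * P₂ z)) =
      ∑ z, R (x, z) * Real.log (R (x, z) / P₂ z) - (∑ z, R (x, z)) * Real.log (P₁ x) := by
    intro x
    rw [Finset.sum_mul, ← Finset.sum_sub_distrib]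
    refine Finset.sum_congr rfl fun z _ => ?_
    rcases (hR (x, z)).eq_or_lt with h | h
    · simp [← h]
    · rw [Real.log_div h.ne' (mul_pos (hP₁ x) (hP₂ z)).ne', Real.log_div h.ne' (hP₂ z).ne',
        Real.log_mul (hP₁ x).ne' (hP₂ z).ne']
      ring
  have h' : ∀ x, (∑ z, R (x, z)) * Real.log ((∑ z, R (x, z)) / P₁ x) =
      (∑ z, R (x, z)) * Real.log (∑ z, R (x, z)) - (∑ z, R (x, z)) * Real.log (P₁ x) := by
    intro x
    rcases eq_or_ne (∑ z, R (x, z)) 0 with h | h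
    · simp [h]
    · rw [Real.log_div h (hP₁ x).ne']
      ring
  rw [Finset.sum_congr rfl fun x _ => h x, Finset.sum_congr rfl fun x _ => h' x,
    Finset.sum_sub_distrib, Finset.sum_sub_distrib]
  ring

theorem ent_comp_equiv (e : α ≃ γ) (R P : γ → ℝ) : ent (R ∘ e) (P ∘ e) = ent R P := by
  unfold ent
  simp only [Function.comp_apply]
  rw [e.sum_comp fun x => R x * Real.log (R x / P x), e.sum_comp R]

/-- The channel `W` with input `P` contracts divergences by the factor `c`. -/
def Contracts (P : α → ℝ) (W : Matrix β α ℝ) (c : ℝ) : Prop :=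
  ∀ R : α → ℝ, (∀ x, 0 ≤ R x) → ent (W.mulVec R) (W.mulVec P) ≤ c * ent R P

theorem Contracts.comp_equiv {P : α → ℝ} {W : Matrix β α ℝ} {c : ℝ} (h : Contracts P W c)
    (e : γ ≃ α) (f : δ ≃ β) : Contracts (P ∘ e) (W.submatrix f e) c := by
  intro R hR
  rw [Matrix.submatrix_mulVec_equiv, Matrix.submatrix_mulVec_equiv, ent_comp_equiv]
  have h1 := h (R ∘ e.symm) fun x => hR _
  rw [← ent_comp_equiv e (R ∘ e.symm) P] at h1
  simpa [Function.comp_assoc] using h1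

/-- Split input and output by the chain rule. The first marginals are related by `W₁`. The output
slice at `y₁` is `W₂` applied to a mixture of the input slices with weights `W₁ y₁ x₁`, so `h₂`
applies; subadditivity and homogeneity of `ent` then break up the mixture, and the columns of `W₁`
sum to one. Homogeneity spares normalizing the slices to conditional pmfs. -/
theorem Contracts.prod {P₁ : α → ℝ} {P₂ : γ → ℝ} {W₁ : Matrix β α ℝ} {W₂ : Matrix δ γ ℝ} {c : ℝ}
    (hc : 0 ≤ c) (h₁ : Contracts P₁ W₁ c) (h₂ : Contracts P₂ W₂ c)
    (hP₁ : ∀ x, 0 < P₁ x) (hP₂ : ∀ x, 0 < P₂ x)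
    (hQ₁ : ∀ y, 0 < W₁.mulVec P₁ y) (hQ₂ : ∀ y, 0 < W₂.mulVec P₂ y)
    (hW₁ : ∀ y x, 0 ≤ W₁ y x) (hW₂ : ∀ y x, 0 ≤ W₂ y x)
    (hs₁ : ∀ x, ∑ y, W₁ y x = 1) (hs₂ : ∀ x, ∑ y, W₂ y x = 1) :
    Contracts (fun x : α × γ => P₁ x.1 * P₂ x.2)
      (Matrix.of fun (y : β × δ) (x : α × γ) => W₁ y.1 x.1 * W₂ y.2 x.2) c := by
  intro R hR
  have hQ : (Matrix.of fun (y : β × δ) (x : α × γ) => W₁ y.1 x.1 * W₂ y.2 x.2).mulVec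
      (fun x : α × γ => P₁ x.1 * P₂ x.2) =
      fun y => W₁.mulVec P₁ y.1 * W₂.mulVec P₂ y.2 := by
    ext y
    simp only [Matrix.mulVec, dotProduct, Matrix.of_apply]
    rw [Fintype.sum_prod_type, Finset.sum_mul_sum]
    exact Finset.sum_congr rfl fun _ _ => Finset.sum_congr rfl fun _ _ => by ring
  set S := (Matrix.of fun (y : β × δ) (x : α × γ) => W₁ y.1 x.1 * W₂ y.2 x.2).mulVec R with hS
  have hS0 : ∀ y, 0 ≤ S y := fun y =>
    Finset.sum_nonneg fun x _ => mul_nonneg (mul_nonneg (hW₁ _ _) (hW₂ _ _)) (hR x)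
  have hS1 : (fun y₁ => ∑ y₂, S (y₁, y₂)) = W₁.mulVec fun x₁ => ∑ x₂, R (x₁, x₂) := by
    ext y₁
    simp only [hS, Matrix.mulVec, dotProduct, Matrix.of_apply, Fintype.sum_prod_type]
    rw [Finset.sum_comm]
    refine Finset.sum_congr rfl fun x₁ _ => ?_
    rw [Finset.sum_comm, Finset.mul_sum]
    refine Finset.sum_congr rfl fun x₂ _ => ?_
    rw [← Finset.sum_mul, ← Finset.mul_sum, hs₂, mul_one]
  have hS2 : ∀ y₁, (fun y₂ => S (y₁, y₂)) =
      W₂.mulVec fun x₂ => ∑ x₁, W₁ y₁ x₁ * R (x₁, x₂) := by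
    intro y₁
    ext y₂
    simp only [hS, Matrix.mulVec, dotProduct, Matrix.of_apply, Fintype.sum_prod_type]
    rw [Finset.sum_comm]
    refine Finset.sum_congr rfl fun x₂ _ => ?_
    rw [Finset.mul_sum]
    exact Finset.sum_congr rfl fun x₁ _ => by ring
  rw [hQ, ent_prod hQ₁ hQ₂ hS0, ent_prod hP₁ hP₂ hR, hS1, mul_add]
  refine add_le_add (h₁ _ fun x => Finset.sum_nonneg fun _ _ => hR _) ?_
  calc ∑ y₁, ent (fun y₂ => S (y₁, y₂)) (W₂.mulVec P₂)
      ≤ ∑ y₁, c * ∑ x₁, W₁ y₁ x₁ * ent (fun x₂ => R (x₁, x₂)) P₂ := by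
        refine Finset.sum_le_sum fun y₁ _ => ?_
        rw [hS2]
        refine (h₂ _ fun x₂ => Finset.sum_nonneg fun x₁ _ =>
          mul_nonneg (hW₁ _ _) (hR _)).trans (mul_le_mul_of_nonneg_left ?_ hc)
        refine (ent_sum_le hP₂ (fun x₁ x₂ => W₁ y₁ x₁ * R (x₁, x₂)) fun x₁ x₂ =>
          mul_nonneg (hW₁ _ _) (hR _)).trans_eq ?_
        exact Finset.sum_congr rfl fun x₁ _ => ent_smul hP₂ (fun x₂ => R (x₁, x₂)) _
    _ = c * ∑ x₁, ent (fun x₂ => R (x₁, x₂)) P₂ := by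
        rw [← Finset.mul_sum, Finset.sum_comm]
        simp_rw [← Finset.sum_mul, hs₁, one_mul]

end Entropy

/-! ### Memoryless sources and channels -/

section Product

variable {α β : Type*}

/-- The product pmf on `n`-tuples. -/
def piPmf (n : ℕ) (P : α → ℝ) : (Fin n → α) → ℝ := fun x => ∏ i, P (x i)

/-- The memoryless extension of a channel to `n`-tuples. -/
def piChannel (n : ℕ) (W : Matrix β α ℝ) : Matrix (Fin n → β) (Fin n → α) ℝ :=
  Matrix.of fun y x => ∏ i, W (y i) (x i)

theorem sum_piPmf [Fintype α] (n : ℕ) (P : α → ℝ) : ∑ x, piPmf n P x = (∑ x, P x) ^ n := by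
  classical
  simp only [piPmf]
  rw [← Fintype.piFinset_univ, ← Finset.prod_univ_sum (fun _ => Finset.univ) fun _ x => P x]
  simp

theorem piChannel_mulVec [Fintype α] (n : ℕ) (W : Matrix β α ℝ) (P : α → ℝ) :
    (piChannel n W).mulVec (piPmf n P) = piPmf n (W.mulVec P) := by
  classical
  ext y
  simp only [piPmf, piChannel, Matrix.mulVec, dotProduct, Matrix.of_apply,
    ← Finset.prod_mul_distrib]
  rw [Finset.prod_univ_sum, Fintype.piFinset_univ]

theorem piChannel_col_sum [Fintype β] {W : Matrix β α ℝ} (hs : ∀ x, ∑ y, W y x = 1) (n : ℕ)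
    (x : Fin n → α) : ∑ y, piChannel n W y x = 1 := by
  classical
  simp only [piChannel, Matrix.of_apply]
  rw [← Fintype.piFinset_univ, ← Finset.prod_univ_sum (fun _ => Finset.univ) fun i y => W y (x i)]
  simp [hs]

theorem piPmf_pos {P : α → ℝ} (hP : ∀ x, 0 < P x) (n : ℕ) (x : Fin n → α) : 0 < piPmf n P x :=
  Finset.prod_pos fun _ _ => hP _

theorem piChannel_nonneg {W : Matrix β α ℝ} (hW : ∀ y x, 0 ≤ W y x) (n : ℕ)
    (y : Fin n → β) (x : Fin n → α) : 0 ≤ piChannel n W y x := by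
  rw [piChannel, Matrix.of_apply]
  exact Finset.prod_nonneg fun _ _ => hW _ _

theorem piPmf_succ (n : ℕ) (P : α → ℝ) :
    piPmf (n + 1) P =
      (fun x : α × (Fin n → α) => P x.1 * piPmf n P x.2) ∘ (Fin.consEquiv fun _ => α).symm := by
  ext x
  simp [piPmf, Fin.consEquiv, Fin.prod_univ_succ, Fin.tail]

theorem piChannel_succ (n : ℕ) (W : Matrix β α ℝ) :
    piChannel (n + 1) W =
      (Matrix.of fun (y : β × (Fin n → β)) (x : α × (Fin n → α)) =>
        W y.1 x.1 * piChannel n W y.2 x.2).submatrix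
        (Fin.consEquiv fun _ => β).symm (Fin.consEquiv fun _ => α).symm := by
  ext y x
  simp [piChannel, Fin.consEquiv, Fin.prod_univ_succ, Fin.tail]

theorem contracts_piPmf_zero [Fintype α] [Fintype β] (P : α → ℝ) (W : Matrix β α ℝ) (c : ℝ) :
    Contracts (piPmf 0 P) (piChannel 0 W) c := by
  intro R _
  simp [ent, piPmf, piChannel, Matrix.mulVec, dotProduct]

theorem Contracts.pi [Fintype α] [Fintype β] {P : α → ℝ} {W : Matrix β α ℝ} {c : ℝ} (hc : 0 ≤ c) (h : Contracts P W c)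
    (hP : ∀ x, 0 < P x) (hQ : ∀ y, 0 < W.mulVec P y) (hW : ∀ y x, 0 ≤ W y x)
    (hs : ∀ x, ∑ y, W y x = 1) (n : ℕ) : Contracts (piPmf n P) (piChannel n W) c := by
  induction n with
  | zero => exact contracts_piPmf_zero P W c
  | succ n ih =>
    rw [piPmf_succ, piChannel_succ]
    refine (Contracts.prod hc h ih hP (piPmf_pos hP n) hQ ?_ hW (piChannel_nonneg hW n) hs
      (piChannel_col_sum hs n)).comp_equiv _ _
    rw [piChannel_mulVec]
    exact piPmf_pos hQ n

end Product

/-! ### The function `φ` and the binary Pinsker inequality -/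

/-- With `s = 1 - 2 * p`, this is the series of `log ((1 + s) / (1 - s))` divided by `s`. Its
coefficients are positive and its powers even, so `φ` is antitone on `(0, 1/2]`. At `p = 1/2` only
the term `k = 0` survives, which explains the value `2`. -/
theorem hasSum_phi {p : ℝ} (hp0 : 0 < p) (hp : p ≤ 1 / 2) :
    HasSum (fun k : ℕ => 2 * (1 / (2 * k + 1)) * (1 - 2 * p) ^ (2 * k)) (phi p) := by
  unfold phi
  split_ifs with h
  · subst h
    convert hasSum_single (f := fun k : ℕ => (2 : ℝ) * (1 / (2 * k + 1)) * (1 - 2 * (1 / 2)) ^ (2 * k))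
      0 ?_ using 1
    · norm_num
    · intro k hk
      norm_num [hk]
  · have hs : 0 < 1 - 2 * p := by
      have := lt_of_le_of_ne hp h
      linarith
    have h1 := (Real.hasSum_log_sub_log_of_abs_lt_one (x := 1 - 2 * p)
      (by rw [abs_of_pos hs]; linarith)).mul_left (1 / (1 - 2 * p))
    have e1 : (fun k : ℕ => 2 * (1 / (2 * (k : ℝ) + 1)) * (1 - 2 * p) ^ (2 * k)) = fun k : ℕ =>
        1 / (1 - 2 * p) * (2 * (1 / (2 * (k : ℝ) + 1)) * (1 - 2 * p) ^ (2 * k + 1)) := by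
      ext k
      rw [pow_succ]
      field_simp
    have e2 : Real.log ((1 - p) / p) =
        Real.log (1 + (1 - 2 * p)) - Real.log (1 - (1 - 2 * p)) := by
      rw [← Real.log_div (by linarith) (by linarith)]
      congr 1
      field_simp
      ring
    rw [e1, e2]
    exact h1

theorem phi_anti {p q : ℝ} (hp : 0 < p) (hpq : p ≤ q) (hq : q ≤ 1 / 2) : phi q ≤ phi p := by
  refine hasSum_le (fun k => ?_) (hasSum_phi (hp.trans_le hpq) hq) (hasSum_phi hp (hpq.trans hq))
  have : (0 : ℝ) ≤ 1 - 2 * q := by linarith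
  gcongr

theorem two_le_phi {p : ℝ} (hp : 0 < p) (hp' : p ≤ 1 / 2) : 2 ≤ phi p := by
  simpa [phi] using phi_anti hp hp' le_rfl

theorem phi_mul_one_sub {p : ℝ} (hp0 : 0 < p) (hp1 : p < 1) :
    phi p * (1 - 2 * p) = Real.log (1 - p) - Real.log p := by
  unfold phi
  split_ifs with h
  · subst h; norm_num
  · have : 1 - 2 * p ≠ 0 := fun h' => h (by linarith)
    rw [Real.log_div (by linarith) hp0.ne']
    field_simp

theorem phi_symm (p : ℝ) : phi (1 - p) = phi p := by
  unfold phi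
  have : 1 - p = 1 / 2 ↔ p = 1 / 2 := by constructor <;> intro h <;> linarith
  simp only [this]
  split_ifs with h
  · rfl
  · rw [sub_sub_cancel, ← inv_div (1 - p) p, Real.log_inv,
      show 1 - 2 * (1 - p) = -(1 - 2 * p) by ring, div_neg]
    ring

/-- Up to an additive constant, `-binEntropy q - phi p * (q - 1 / 2) ^ 2` is the gap in the
binary Pinsker inequality at `p`; on `[0, 1 / 2]` it is smallest at `q = p`. -/
theorem binEntropy_gap_half {p q : ℝ} (hp : 0 < p) (hp' : p ≤ 1 / 2) (hq : 0 ≤ q)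
    (hq' : q ≤ 1 / 2) :
    Real.binEntropy q + phi p * (q - 1 / 2) ^ 2 ≤ Real.binEntropy p + phi p * (p - 1 / 2) ^ 2 := by
  set k : ℝ → ℝ := fun q => Real.binEntropy q + phi p * (q - 1 / 2) ^ 2 with hk
  have hcont : Continuous k := by
    have := Real.binEntropy_continuous
    fun_prop
  -- Antitonicity of `φ` fixes the sign: `k` increases up to `p` and decreases from there to `1/2`.
  have hderiv : ∀ x, 0 < x → x ≤ 1 / 2 → HasDerivAt k ((phi x - phi p) * (1 - 2 * x)) x := by
    intro x hx hx'
    have h1 := (Real.hasDerivAt_binEntropy hx.ne' (by linarith : x ≠ 1)).add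
      ((((hasDerivAt_id x).sub_const (1 / 2)).pow 2).const_mul (phi p))
    refine h1.congr_deriv ?_
    rw [← phi_mul_one_sub hx (by linarith)]
    simp
    ring
  rcases le_total q p with h | h
  · have : MonotoneOn k (Set.Icc 0 p) := by
      refine monotoneOn_of_deriv_nonneg (convex_Icc _ _) hcont.continuousOn ?_ ?_
      · intro x hx
        rw [interior_Icc] at hx
        exact (hderiv x hx.1 (hx.2.le.trans hp')).differentiableAt.differentiableWithinAt
      · intro x hx
        rw [interior_Icc] at hx
        rw [(hderiv x hx.1 (hx.2.le.trans hp')).deriv]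
        exact mul_nonneg (sub_nonneg.2 (phi_anti hx.1 hx.2.le hp')) (by linarith [hx.2])
    exact this ⟨hq, h⟩ ⟨hp.le, le_rfl⟩ h
  · have : AntitoneOn k (Set.Icc p (1 / 2)) := by
      refine antitoneOn_of_deriv_nonpos (convex_Icc _ _) hcont.continuousOn ?_ ?_
      · intro x hx
        rw [interior_Icc] at hx
        exact (hderiv x (hp.trans hx.1) hx.2.le).differentiableAt.differentiableWithinAt
      · intro x hx
        rw [interior_Icc] at hx
        rw [(hderiv x (hp.trans hx.1) hx.2.le).deriv]
        exact mul_nonpos_of_nonpos_of_nonneg (sub_nonpos.2 (phi_anti hp hx.1.le hx.2.le))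
          (by linarith [hx.2])
    exact this ⟨le_rfl, hp'⟩ ⟨h, hq'⟩ h

theorem binEntropy_gap {p q : ℝ} (hp : 0 < p) (hp' : p ≤ 1 / 2) (hq : 0 ≤ q) (hq' : q ≤ 1) :
    Real.binEntropy q + phi p * (q - 1 / 2) ^ 2 ≤ Real.binEntropy p + phi p * (p - 1 / 2) ^ 2 := by
  rcases le_total q (1 / 2) with h | h
  · exact binEntropy_gap_half hp hp' hq h
  · have := binEntropy_gap_half hp hp' (q := 1 - q) (by linarith) (by linarith)
    rwa [Real.binEntropy_one_sub, show (1 - q - 1 / 2) ^ 2 = (q - 1 / 2) ^ 2 by ring] at this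

theorem mul_log_div {q p : ℝ} (hp : p ≠ 0) :
    q * Real.log (q / p) = q * Real.log q - q * Real.log p := by
  rcases eq_or_ne q 0 with rfl | h
  · simp
  · rw [Real.log_div h hp]
    ring

theorem binary_pinsker_half {p q : ℝ} (hp : 0 < p) (hp' : p ≤ 1 / 2) (hq : 0 ≤ q) (hq' : q ≤ 1) :
    phi p * (q - p) ^ 2 ≤
      q * Real.log (q / p) + (1 - q) * Real.log ((1 - q) / (1 - p)) := by
  have h := binEntropy_gap hp hp' hq hq'
  have h1 := phi_mul_one_sub hp (by linarith)
  rw [mul_log_div hp.ne', mul_log_div (by linarith)]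
  simp only [Real.binEntropy, Real.log_inv] at h
  -- The binary divergence is `h(p) - h(q) + (q - p) * (log (1 - p) - log p)`. Expanding the square
  -- about `1/2` yields the same linear term, and what remains is `binEntropy_gap`.
  have h2 : phi p * (q - p) ^ 2 = phi p * (q - 1 / 2) ^ 2 - phi p * (p - 1 / 2) ^ 2 +
      (q - p) * (phi p * (1 - 2 * p)) := by ring
  rw [h2, h1]
  nlinarith [h]

theorem binary_pinsker {p q : ℝ} (hp : 0 < p) (hp' : p < 1) (hq : 0 ≤ q) (hq' : q ≤ 1) :
    phi p * (q - p) ^ 2 ≤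
      q * Real.log (q / p) + (1 - q) * Real.log ((1 - q) / (1 - p)) := by
  rcases le_total p (1 / 2) with h | h
  · exact binary_pinsker_half hp h hq hq'
  · have := binary_pinsker_half (p := 1 - p) (q := 1 - q) (by linarith) (by linarith)
      (by linarith) (by linarith)
    rw [phi_symm, sub_sub_cancel, sub_sub_cancel,
      show (1 - q - (1 - p)) ^ 2 = (q - p) ^ 2 by ring] at this
    linarith

/-! ### From `χ²` to KL contraction for one letter -/

section Simplex

variable {α β : Type*}

theorem mulVec_nonneg [Fintype α] {W : Matrix β α ℝ} (hW : ∀ y x, 0 ≤ W y x) {R : α → ℝ}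
    (hR : ∀ x, 0 ≤ R x) (y : β) : 0 ≤ W.mulVec R y :=
  Finset.sum_nonneg fun x _ => mul_nonneg (hW y x) (hR x)

variable [Fintype α] [Fintype β]

theorem sum_mulVec {W : Matrix β α ℝ} (hs : ∀ x, ∑ y, W y x = 1) (R : α → ℝ) :
    ∑ y, W.mulVec R y = ∑ x, R x := by
  simp only [Matrix.mulVec, dotProduct]
  rw [Finset.sum_comm]
  simp_rw [← Finset.sum_mul, hs, one_mul]

theorem mulVec_mem_stdSimplex {W : Matrix β α ℝ} (hW : ∀ y x, 0 ≤ W y x)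
    (hs : ∀ x, ∑ y, W y x = 1) {R : α → ℝ} (hR : R ∈ stdSimplex ℝ α) :
    W.mulVec R ∈ stdSimplex ℝ β :=
  ⟨mulVec_nonneg hW hR.1, (sum_mulVec hs R).trans hR.2⟩

theorem ent_of_sum_eq_one {R P : α → ℝ} (hR : ∑ x, R x = 1) :
    ent R P = ∑ x, R x * Real.log (R x / P x) := by
  simp [ent, hR]

theorem klDiv_of_pos {R P : α → ℝ} (hP : ∀ x, 0 < P x) (hR : ∑ x, R x = 1) :
    klDiv R P = ENNReal.ofReal (ent R P) := by
  rw [klDiv, if_pos fun x h => absurd h (hP x).ne', ent_of_sum_eq_one hR]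

theorem chiSqDiv_of_pos {P : α → ℝ} (hP : ∀ x, 0 < P x) (R : α → ℝ) :
    chiSqDiv R P = ENNReal.ofReal (∑ x, (R x - P x) ^ 2 / P x) := by
  rw [chiSqDiv, if_pos fun x h => absurd h (hP x).ne']

theorem etaKL_le_of_contracts {P : α → ℝ} {W : Matrix β α ℝ} {c : ℝ} (hc : 0 ≤ c)
    (h : Contracts P W c) (hP : ∀ x, 0 < P x) (hQ : ∀ y, 0 < W.mulVec P y)
    (hs : ∀ x, ∑ y, W y x = 1) : etaKL P W ≤ ENNReal.ofReal c := by
  refine iSup₂_le fun R hR => ?_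
  refine ENNReal.div_le_of_le_mul ?_
  rw [klDiv_of_pos hQ ((sum_mulVec hs R).trans hR.1.2), klDiv_of_pos hP hR.1.2,
    ← ENNReal.ofReal_mul hc]
  exact ENNReal.ofReal_le_ofReal (h R hR.1.1)

theorem chiSq_sum_nonneg {P : α → ℝ} (hP : ∀ x, 0 < P x) (R : α → ℝ) :
    0 ≤ ∑ x, (R x - P x) ^ 2 / P x :=
  Finset.sum_nonneg fun x _ => div_nonneg (sq_nonneg _) (hP x).le

theorem chiSq_le_of_etaChiSq {P : α → ℝ} {W : Matrix β α ℝ} (hP : ∀ x, 0 < P x)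
    (hQ : ∀ y, 0 < W.mulVec P y) (hfin : etaChiSq P W ≠ ⊤) {R : α → ℝ}
    (hR : R ∈ stdSimplex ℝ α) :
    ∑ y, (W.mulVec R y - W.mulVec P y) ^ 2 / W.mulVec P y ≤
      (etaChiSq P W).toReal * ∑ x, (R x - P x) ^ 2 / P x := by
  -- The supremum excludes `R` with zero divergence; then `R = P` and both sides vanish.
  rcases (chiSq_sum_nonneg hP R).eq_or_lt with h | h
  · have h1 := (Finset.sum_eq_zero_iff_of_nonneg fun x _ =>
      div_nonneg (sq_nonneg (R x - P x)) (hP x).le).1 h.symm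
    have h2 : R = P := by
      ext x
      have h3 := h1 x (Finset.mem_univ x)
      rw [div_eq_zero_iff, or_iff_left (hP x).ne', sq_eq_zero_iff] at h3
      linarith
    simp [h2]
  · have hpos : 0 < chiSqDiv R P := by rw [chiSqDiv_of_pos hP]; exact ENNReal.ofReal_pos.2 h
    have hlt : chiSqDiv R P < ⊤ := by rw [chiSqDiv_of_pos hP]; exact ENNReal.ofReal_lt_top
    have h1 : chiSqDiv (W.mulVec R) (W.mulVec P) / chiSqDiv R P ≤ etaChiSq P W :=
      le_iSup₂_of_le (f := fun R _ => chiSqDiv (W.mulVec R) (W.mulVec P) / chiSqDiv R P)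
        R ⟨hR, hpos, hlt⟩ le_rfl
    rw [ENNReal.div_le_iff hpos.ne' hlt.ne, chiSqDiv_of_pos hP, chiSqDiv_of_pos hQ,
      ← ENNReal.ofReal_toReal hfin, ← ENNReal.ofReal_mul ENNReal.toReal_nonneg] at h1
    exact (ENNReal.ofReal_le_ofReal_iff (mul_nonneg ENNReal.toReal_nonneg h.le)).1 h1

theorem ent_nonneg {R P : α → ℝ} (hR : R ∈ stdSimplex ℝ α) (hP : ∀ x, 0 < P x)
    (hP1 : ∑ x, P x = 1) : 0 ≤ ent R P := by
  have := log_sum_inequality Finset.univ R P (fun x _ => hR.1 x) (fun x _ => (hP x).le)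
    fun x _ h => absurd h (hP x).ne'
  rw [ent_of_sum_eq_one hR.2]
  simpa [hR.2, hP1] using this

/-- Apply `log t ≤ t - 1` to `t = R x / P x`; the linear excess `R x - P x` sums to zero. -/
theorem ent_le_chiSq {R P : α → ℝ} (hR : R ∈ stdSimplex ℝ α) (hP : ∀ x, 0 < P x)
    (hP1 : ∑ x, P x = 1) : ent R P ≤ ∑ x, (R x - P x) ^ 2 / P x := by
  have h : ∀ x ∈ Finset.univ, R x * Real.log (R x / P x) ≤
      (R x - P x) ^ 2 / P x + (R x - P x) := by
    intro x _
    have h2 : (R x - P x) ^ 2 / P x + (R x - P x) = R x * (R x / P x - 1) := by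
      have := (hP x).ne'
      field_simp
      ring
    rw [h2]
    rcases (hR.1 x).eq_or_lt with h | h
    · rw [← h, zero_mul, zero_mul]
    · exact mul_le_mul_of_nonneg_left (Real.log_le_sub_one_of_pos (div_pos h (hP x))) h.le
  have := Finset.sum_le_sum h
  rw [Finset.sum_add_distrib, Finset.sum_sub_distrib, hR.2, hP1] at this
  rw [ent_of_sum_eq_one hR.2]
  linarith

theorem le_maxBalance (P : α → ℝ) (A : Finset α) :
    min (∑ x ∈ A, P x) (1 - ∑ x ∈ A, P x) ≤ maxBalance P :=
  Finset.le_sup' (fun A : Finset α => min (∑ x ∈ A, P x) (1 - ∑ x ∈ A, P x)) (Finset.mem_univ A)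

theorem maxBalance_le_half (P : α → ℝ) : maxBalance P ≤ 1 / 2 := by
  refine Finset.sup'_le _ _ fun A _ => ?_
  rcases le_total (∑ x ∈ A, P x) (1 / 2) with h | h
  · exact min_le_of_left_le h
  · exact min_le_of_right_le (by linarith)

/-- The total variation distance of pmfs. -/
noncomputable def tv (R P : α → ℝ) : ℝ := ∑ x with P x ≤ R x, (R x - P x)

/-- The distribution dependent Pinsker inequality. -/
theorem pinsker {R P : α → ℝ} (hR : R ∈ stdSimplex ℝ α) (hP : ∀ x, 0 < P x)
    (hP1 : ∑ x, P x = 1) : phi (maxBalance P) * tv R P ^ 2 ≤ ent R P := by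
  classical
  set A : Finset α := Finset.univ.filter fun x => P x ≤ R x with hA
  have htv : tv R P = ∑ x ∈ A, R x - ∑ x ∈ A, P x := Finset.sum_sub_distrib _ _
  have hcR : ∑ x ∈ Aᶜ, R x = 1 - ∑ x ∈ A, R x := by
    rw [← hR.2, ← Finset.sum_add_sum_compl A R]; ring
  have hcP : ∑ x ∈ Aᶜ, P x = 1 - ∑ x ∈ A, P x := by
    rw [← hP1, ← Finset.sum_add_sum_compl A P]; ring
  -- If `A` or its complement is empty, `tv R P` is zero, and `binary_pinsker` would lack `0 < p <
  -- 1`.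
  rcases A.eq_empty_or_nonempty with h0 | h0
  · rw [htv, h0]
    simpa using ent_nonneg hR hP hP1
  rcases Aᶜ.eq_empty_or_nonempty with h1 | h1
  · rw [h1, Finset.sum_empty] at hcR hcP
    rw [htv, ← sub_eq_zero.1 hcR.symm, ← sub_eq_zero.1 hcP.symm]
    simpa using ent_nonneg hR hP hP1
  have hp0 : 0 < ∑ x ∈ A, P x := Finset.sum_pos (fun x _ => hP x) h0
  have hp1 : 0 < ∑ x ∈ Aᶜ, P x := Finset.sum_pos (fun x _ => hP x) h1
  have hq0 : 0 ≤ ∑ x ∈ A, R x := Finset.sum_nonneg fun x _ => hR.1 x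
  have hq1 : 0 ≤ ∑ x ∈ Aᶜ, R x := Finset.sum_nonneg fun x _ => hR.1 x
  -- Data processing: merging each of `A` and `Aᶜ` to a point leaves a binary divergence.
  have hls := fun B : Finset α => log_sum_inequality B R P (fun x _ => hR.1 x)
    (fun x _ => (hP x).le) fun x _ h => absurd h (hP x).ne'
  have h2 := add_le_add (hls A) (hls Aᶜ)
  rw [Finset.sum_add_sum_compl A fun x => R x * Real.log (R x / P x), hcR, hcP,
    ← ent_of_sum_eq_one hR.2] at h2
  rw [hcR] at hq1
  rw [hcP] at hp1
  have h3 := binary_pinsker (p := ∑ x ∈ A, P x) (q := ∑ x ∈ A, R x) hp0 (by linarith) hq0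
    (by linarith)
  have h4 : phi (maxBalance P) ≤ phi (∑ x ∈ A, P x) := by
    have h5 := phi_anti (lt_min hp0 hp1) (le_maxBalance P A) (maxBalance_le_half P)
    rcases min_choice (∑ x ∈ A, P x) (1 - ∑ x ∈ A, P x) with h | h
    · rwa [h] at h5
    · rwa [h, phi_symm] at h5
  rw [htv]
  exact (mul_le_mul_of_nonneg_right h4 (sq_nonneg _)).trans (h3.trans h2)

theorem chiSq_le_tv {R P : α → ℝ} {m : ℝ} (hm : 0 < m) (hmP : ∀ x, m ≤ P x)
    (hRP : ∑ x, R x = ∑ x, P x) :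
    ∑ x, (R x - P x) ^ 2 / P x ≤ 2 * tv R P ^ 2 / m := by
  classical
  have hsum : (∑ x with P x ≤ R x, (R x - P x)) + ∑ x with ¬ P x ≤ R x, (R x - P x) = 0 := by
    rw [Finset.sum_filter_add_sum_filter_not, Finset.sum_sub_distrib, hRP, sub_self]
  have habs : ∑ x, |R x - P x| = 2 * tv R P := by
    rw [← Finset.sum_filter_add_sum_filter_not _ fun x => P x ≤ R x]
    have h1 : ∑ x with P x ≤ R x, |R x - P x| = ∑ x with P x ≤ R x, (R x - P x) :=
      Finset.sum_congr rfl fun x hx => abs_of_nonneg (sub_nonneg.2 (Finset.mem_filter.1 hx).2)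
    have h2 : ∑ x with ¬ P x ≤ R x, |R x - P x| = -∑ x with ¬ P x ≤ R x, (R x - P x) := by
      rw [← Finset.sum_neg_distrib]
      exact Finset.sum_congr rfl fun x hx =>
        abs_of_nonpos (sub_nonpos.2 (not_le.1 (Finset.mem_filter.1 hx).2).le)
    rw [h1, h2, tv]
    linarith
  -- The other differences sum to the negative of this one, so it is at most half of the total `2 *
  -- tv R P`. Hence the factor `2` in the bound rather than `4`.
  have hle : ∀ x, |R x - P x| ≤ tv R P := by
    intro x
    have h1 : |∑ z ∈ Finset.univ.erase x, (R z - P z)| ≤ ∑ z ∈ Finset.univ.erase x, |R z - P z| :=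
      Finset.abs_sum_le_sum_abs _ _
    have h2 := Finset.sum_erase_add Finset.univ (fun z => R z - P z) (Finset.mem_univ x)
    have h3 := Finset.sum_erase_add Finset.univ (fun z => |R z - P z|) (Finset.mem_univ x)
    rw [Finset.sum_sub_distrib (s := Finset.univ), hRP, sub_self] at h2
    rw [habs] at h3
    rw [eq_neg_of_add_eq_zero_left h2, abs_neg] at h1
    linarith
  calc ∑ x, (R x - P x) ^ 2 / P x ≤ ∑ x, |R x - P x| * (tv R P / m) := by
        refine Finset.sum_le_sum fun x _ => ?_
        rw [← sq_abs, sq, mul_div_assoc]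
        have := hle x
        have := hmP x
        have := abs_nonneg (R x - P x)
        gcongr
        linarith
    _ = 2 * tv R P ^ 2 / m := by
        rw [← Finset.sum_mul, habs]
        ring

variable [Nontrivial α]

theorem maxBalance_pos {P : α → ℝ} (hP : ∀ x, 0 < P x) (hP1 : ∑ x, P x = 1) :
    0 < maxBalance P := by
  classical
  obtain ⟨a, b, hab⟩ := exists_pair_ne α
  refine lt_of_lt_of_le (lt_min ?_ ?_) (le_maxBalance P {a})
  · simpa using hP a
  · have h := Finset.add_le_sum (s := Finset.univ) (fun x _ => (hP x).le) (Finset.mem_univ a)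
      (Finset.mem_univ b) hab
    have := hP b
    rw [hP1] at h
    simp only [Finset.sum_singleton]
    linarith

theorem minProb_pos {P : α → ℝ} (hP : ∀ x, 0 < P x) : 0 < minProb P :=
  (Finset.lt_inf'_iff _).2 fun x _ => hP x

theorem phi_mul_minProb_pos {P : α → ℝ} (hP : ∀ x, 0 < P x) (hP1 : ∑ x, P x = 1) :
    0 < phi (maxBalance P) * minProb P :=
  mul_pos (two_pos.trans_le (two_le_phi (maxBalance_pos hP hP1) (maxBalance_le_half P)))
    (minProb_pos hP)

theorem contracts_of_chiSq {P : α → ℝ} {W : Matrix β α ℝ} {e : ℝ} (he : 0 ≤ e)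
    (hP : ∀ x, 0 < P x) (hP1 : ∑ x, P x = 1) (hQ : ∀ y, 0 < W.mulVec P y)
    (hW : ∀ y x, 0 ≤ W y x) (hs : ∀ x, ∑ y, W y x = 1)
    (h : ∀ R ∈ stdSimplex ℝ α, ∑ y, (W.mulVec R y - W.mulVec P y) ^ 2 / W.mulVec P y ≤
      e * ∑ x, (R x - P x) ^ 2 / P x) :
    Contracts P W (2 * e / (phi (maxBalance P) * minProb P)) := by
  have hm := minProb_pos hP
  have hφ : 0 < phi (maxBalance P) :=
    two_pos.trans_le (two_le_phi (maxBalance_pos hP hP1) (maxBalance_le_half P))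
  have key : ∀ R ∈ stdSimplex ℝ α, ent (W.mulVec R) (W.mulVec P) ≤
      2 * e / (phi (maxBalance P) * minProb P) * ent R P := by
    intro R hR
    calc ent (W.mulVec R) (W.mulVec P)
        ≤ ∑ y, (W.mulVec R y - W.mulVec P y) ^ 2 / W.mulVec P y :=
          ent_le_chiSq (mulVec_mem_stdSimplex hW hs hR) hQ ((sum_mulVec hs P).trans hP1)
      _ ≤ e * ∑ x, (R x - P x) ^ 2 / P x := h R hR
      _ ≤ e * (2 * tv R P ^ 2 / minProb P) :=
          mul_le_mul_of_nonneg_left (chiSq_le_tv hm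
            (fun x => Finset.inf'_le _ (Finset.mem_univ x)) (hR.2.trans hP1.symm)) he
      _ = 2 * e / (phi (maxBalance P) * minProb P) * (phi (maxBalance P) * tv R P ^ 2) := by
          field_simp
      _ ≤ _ := mul_le_mul_of_nonneg_left (pinsker hR hP hP1) (by positivity)
  -- Both sides are homogeneous, so the bound for pmfs extends to all nonnegative vectors.
  intro R hR
  rcases (Finset.sum_nonneg fun x _ => hR x : 0 ≤ ∑ x, R x).eq_or_lt with h0 | h0
  · have h1 : R = fun _ => 0 := funext fun x =>
      (Finset.sum_eq_zero_iff_of_nonneg fun x _ => hR x).1 h0.symm x (Finset.mem_univ x)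
    subst h1
    simp [ent, Matrix.mulVec, dotProduct]
  · set t := ∑ x, R x with ht
    have hmem : (fun x => t⁻¹ * R x) ∈ stdSimplex ℝ α :=
      ⟨fun x => mul_nonneg (inv_nonneg.2 h0.le) (hR x), by
        rw [← Finset.mul_sum, ← ht, inv_mul_cancel₀ h0.ne']⟩
    have h1 := key _ hmem
    have h2 : W.mulVec (fun x => t⁻¹ * R x) = fun y => t⁻¹ * W.mulVec R y :=
      W.mulVec_smul t⁻¹ R
    rw [h2, ent_smul hQ, ent_smul hP, mul_left_comm] at h1
    exact le_of_mul_le_mul_left h1 (inv_pos.2 h0)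

end Simplex

/-! ### Second-order expansion of KL divergence -/

section LocalLimit

variable {α β : Type*} [Fintype α] [Fintype β]

open Filter Topology

/-- One use of L'Hôpital leaves `u * log (1 + ε * u) / (2 * ε)`, a multiple of a difference quotient
of `log (1 + ε * u)` at `0`. -/
theorem tendsto_mul_log_div_sq (u : ℝ) :
    Tendsto (fun ε : ℝ => ((1 + ε * u) * Real.log (1 + ε * u) - ε * u) / ε ^ 2)
      (𝓝[>] 0) (𝓝 (u ^ 2 / 2)) := by
  have hlin : ∀ ε : ℝ, HasDerivAt (fun ε : ℝ => 1 + ε * u) u ε := fun ε => by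
    simpa using ((hasDerivAt_id ε).mul_const u).const_add 1
  have hcont : Tendsto (fun ε : ℝ => 1 + ε * u) (𝓝[>] 0) (𝓝 1) := by
    have := (hlin 0).continuousAt.tendsto
    rw [zero_mul, add_zero] at this
    exact this.mono_left nhdsWithin_le_nhds
  have hpos : ∀ᶠ ε : ℝ in 𝓝[>] 0, 0 < 1 + ε * u := hcont.eventually (lt_mem_nhds one_pos)
  refine HasDerivAt.lhopital_zero_nhdsGT (f' := fun ε => u * Real.log (1 + ε * u))
    (g' := fun ε => 2 * ε) ?_ ?_ ?_ ?_ ?_ ?_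
  · filter_upwards [hpos] with ε hε
    refine (((hlin ε).mul ((hlin ε).log hε.ne')).sub ((hasDerivAt_id ε).mul_const u)).congr_deriv ?_
    rw [mul_div_cancel₀ u hε.ne']
    ring
  · exact Eventually.of_forall fun ε => by simpa using hasDerivAt_pow 2 ε
  · filter_upwards [self_mem_nhdsWithin] with ε hε
    exact (mul_pos two_pos hε).ne'
  · have h1 := (hcont.mul (hcont.log one_ne_zero)).sub (hcont.sub_const 1)
    simpa using h1
  · have h1 : Tendsto (fun ε : ℝ => ε ^ 2) (𝓝 0) (𝓝 (0 ^ 2)) := (continuous_pow 2).tendsto 0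
    rw [zero_pow two_ne_zero] at h1
    exact h1.mono_left nhdsWithin_le_nhds
  · have h1 := ((hlin 0).log (by simp)).tendsto_slope.mono_left
      (nhdsWithin_mono (0 : ℝ) fun x (hx : x ∈ Set.Ioi (0 : ℝ)) => ne_of_gt hx)
    have h2 := h1.const_mul (u / 2)
    have h3 : u / 2 * (u / (1 + 0 * u)) = u ^ 2 / 2 := by
      rw [zero_mul, add_zero, div_one]
      ring
    rw [h3] at h2
    refine h2.congr' ?_
    filter_upwards [self_mem_nhdsWithin] with ε hε
    have : ε ≠ 0 := ne_of_gt hε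
    simp only [slope_def_field, zero_mul, add_zero, Real.log_one, sub_zero]
    field_simp

theorem tendsto_ent_div_sq {R P : α → ℝ} (hP : ∀ x, 0 < P x) (hP1 : ∑ x, P x = 1)
    (hR : ∑ x, R x = 1) :
    Tendsto (fun ε : ℝ => ent (fun x => P x + ε * (R x - P x)) P / ε ^ 2) (𝓝[>] 0)
      (𝓝 ((∑ x, (R x - P x) ^ 2 / P x) / 2)) := by
  have h := tendsto_finsetSum Finset.univ fun x _ =>
    (tendsto_mul_log_div_sq ((R x - P x) / P x)).const_mul (P x)
  have h1 : ∑ x, P x * (((R x - P x) / P x) ^ 2 / 2) = (∑ x, (R x - P x) ^ 2 / P x) / 2 := by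
    rw [Finset.sum_div]
    refine Finset.sum_congr rfl fun x _ => ?_
    have := (hP x).ne'
    field_simp
  rw [h1] at h
  refine h.congr fun ε => ?_
  -- Zero total perturbation makes the first-order corrections cancel.
  have h0 : ∑ x, (R x - P x) = 0 := by rw [Finset.sum_sub_distrib, hR, hP1, sub_self]
  have hsum : ∑ x, (P x + ε * (R x - P x)) = 1 := by
    rw [Finset.sum_add_distrib, ← Finset.mul_sum, h0, hP1, mul_zero, add_zero]
  have h2 : ∑ x, P x * (((1 + ε * ((R x - P x) / P x)) * Real.log (1 + ε * ((R x - P x) / P x)) -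
      ε * ((R x - P x) / P x)) / ε ^ 2) =
      (∑ x, (P x + ε * (R x - P x)) * Real.log ((P x + ε * (R x - P x)) / P x) -
        ε * ∑ x, (R x - P x)) / ε ^ 2 := by
    rw [Finset.mul_sum, ← Finset.sum_sub_distrib, Finset.sum_div]
    refine Finset.sum_congr rfl fun x _ => ?_
    have hx := (hP x).ne'
    have h3 : (P x + ε * (R x - P x)) / P x = 1 + ε * ((R x - P x) / P x) := by
      field_simp
    rw [h3, ← mul_div_assoc]
    congr 1
    field_simp
  rw [h2, h0, ent_of_sum_eq_one hsum, mul_zero, sub_zero]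

theorem etaChiSq_le_etaKL {P : α → ℝ} {W : Matrix β α ℝ} (hP : ∀ x, 0 < P x)
    (hP1 : ∑ x, P x = 1) (hQ : ∀ y, 0 < W.mulVec P y) (hs : ∀ x, ∑ y, W y x = 1) :
    etaChiSq P W ≤ etaKL P W := by
  rcases eq_or_ne (etaKL P W) ⊤ with htop | hfin
  · rw [htop]
    exact le_top
  refine iSup₂_le fun R hR => ENNReal.div_le_of_le_mul ?_
  obtain ⟨hR, hpos, -⟩ := hR
  rw [chiSqDiv_of_pos hP, ENNReal.ofReal_pos] at hpos
  have hWP1 := (sum_mulVec hs P).trans hP1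
  have hlim₁ := tendsto_ent_div_sq hP hP1 hR.2
  have hlim₂ := tendsto_ent_div_sq hQ hWP1 ((sum_mulVec hs R).trans hR.2)
  have hle := le_of_tendsto_of_tendsto hlim₂ (hlim₁.const_mul (etaKL P W).toReal) ?_
  · rw [chiSqDiv_of_pos hP, chiSqDiv_of_pos hQ, ← ENNReal.ofReal_toReal hfin,
      ← ENNReal.ofReal_mul ENNReal.toReal_nonneg]
    refine ENNReal.ofReal_le_ofReal ?_
    linarith
  · filter_upwards [hlim₁.eventually (lt_mem_nhds (half_pos hpos)), self_mem_nhdsWithin,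
      nhdsWithin_le_nhds (gt_mem_nhds one_pos)] with ε hε hε0 hε1
    have hε0 : 0 < ε := hε0
    set S : α → ℝ := fun x => P x + ε * (R x - P x) with hS
    have hS1 : ∑ x, S x = 1 := by
      rw [hS, Finset.sum_add_distrib, ← Finset.mul_sum, Finset.sum_sub_distrib, hR.2, hP1]
      ring
    have hSmem : S ∈ stdSimplex ℝ α := by
      refine ⟨fun x => ?_, hS1⟩
      have h1 := mul_nonneg hε0.le (hR.1 x)
      have h2 := mul_nonneg (sub_nonneg.2 hε1.le) (hP x).le
      simp only [hS]
      linarith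
    have hent : 0 < ent S P := by
      by_contra hneg
      exact absurd hε (not_lt.2 (div_nonpos_of_nonpos_of_nonneg (not_lt.1 hneg) (sq_nonneg ε)))
    have hWS : W.mulVec S = fun y => W.mulVec P y + ε * (W.mulVec R y - W.mulVec P y) := by
      have : S = P + ε • (R - P) := rfl
      rw [this, Matrix.mulVec_add, Matrix.mulVec_smul, Matrix.mulVec_sub]
      rfl
    have hk := klDiv_of_pos hP hS1
    have hk0 : 0 < klDiv S P := by rw [hk]; exact ENNReal.ofReal_pos.2 hent
    have hkt : klDiv S P < ⊤ := by rw [hk]; exact ENNReal.ofReal_lt_top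
    have h1 : klDiv (W.mulVec S) (W.mulVec P) / klDiv S P ≤ etaKL P W :=
      le_iSup₂_of_le (f := fun R _ => klDiv (W.mulVec R) (W.mulVec P) / klDiv R P)
        S ⟨hSmem, hk0, hkt⟩ le_rfl
    rw [ENNReal.div_le_iff hk0.ne' hkt.ne, hk, klDiv_of_pos hQ ((sum_mulVec hs S).trans hS1),
      ← ENNReal.ofReal_toReal hfin, ← ENNReal.ofReal_mul ENNReal.toReal_nonneg,
      ENNReal.ofReal_le_ofReal_iff (mul_nonneg ENNReal.toReal_nonneg hent.le), hWS] at h1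
    rw [← mul_div_assoc]
    exact div_le_div_of_nonneg_right h1 (sq_nonneg ε)

end LocalLimit

/-! ### Comparison of one letter with `n` letters -/

section Tensor

variable {α β γ : Type*} [Fintype α] [Fintype β] [Fintype γ]

theorem chiSqDiv_comp_equiv (e : α ≃ γ) {P : γ → ℝ} (hP : ∀ x, 0 < P x) (R : γ → ℝ) :
    chiSqDiv (R ∘ e) (P ∘ e) = chiSqDiv R P := by
  rw [chiSqDiv_of_pos hP, chiSqDiv_of_pos (P := P ∘ e) fun x => hP (e x)]
  simp only [Function.comp_apply]
  rw [e.sum_comp fun x => (R x - P x) ^ 2 / P x]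

theorem chiSqDiv_prod_right {P : α → ℝ} {P' : γ → ℝ} (hP : ∀ x, 0 < P x) (hP' : ∀ x, 0 < P' x)
    (hP1 : ∑ x, P' x = 1) (R : α → ℝ) :
    chiSqDiv (fun x : α × γ => R x.1 * P' x.2) (fun x => P x.1 * P' x.2) = chiSqDiv R P := by
  rw [chiSqDiv_of_pos hP, chiSqDiv_of_pos fun x => mul_pos (hP _) (hP' _), Fintype.sum_prod_type]
  congr 1
  refine Finset.sum_congr rfl fun x _ => ?_
  have h : ∀ z, (R x * P' z - P x * P' z) ^ 2 / (P x * P' z) =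
      (R x - P x) ^ 2 / P x * P' z := by
    intro z
    have := (hP x).ne'
    have := (hP' z).ne'
    field_simp
  simp only [h]
  rw [← Finset.mul_sum, hP1, mul_one]

/-- Perturb only the first coordinate: `R ⊗ P^n` has the same input and output `χ²` as `R`, so each
one-letter ratio reappears. -/
theorem etaChiSq_le_pi_succ {P : α → ℝ} {W : Matrix β α ℝ} (hP : ∀ x, 0 < P x)
    (hP1 : ∑ x, P x = 1) (hQ : ∀ y, 0 < W.mulVec P y) (hs : ∀ x, ∑ y, W y x = 1) (n : ℕ) :
    etaChiSq P W ≤ etaChiSq (piPmf (n + 1) P) (piChannel (n + 1) W) := by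
  have hPn : ∑ x, piPmf n P x = 1 := by rw [sum_piPmf, hP1, one_pow]
  have hQn : ∑ y, piPmf n (W.mulVec P) y = 1 := by rw [sum_piPmf, sum_mulVec hs, hP1, one_pow]
  refine iSup₂_le fun R hR => ?_
  set S : (Fin (n + 1) → α) → ℝ :=
    (fun x : α × (Fin n → α) => R x.1 * piPmf n P x.2) ∘ (Fin.consEquiv fun _ => α).symm with hS
  have hχ : chiSqDiv S (piPmf (n + 1) P) = chiSqDiv R P := by
    rw [piPmf_succ, hS, chiSqDiv_comp_equiv _ fun x => mul_pos (hP _) (piPmf_pos hP n _),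
      chiSqDiv_prod_right hP (piPmf_pos hP n) hPn]
  have hWS : (piChannel (n + 1) W).mulVec S =
      (fun y : β × (Fin n → β) => W.mulVec R y.1 * piPmf n (W.mulVec P) y.2) ∘
        (Fin.consEquiv fun _ => β).symm := by
    rw [piChannel_succ, Matrix.submatrix_mulVec_equiv]
    congr 1
    ext y
    rw [hS, Function.comp_assoc, Equiv.symm_symm, Equiv.symm_comp_self, Function.comp_id,
      ← piChannel_mulVec]
    simp only [Matrix.mulVec, dotProduct, Matrix.of_apply]
    rw [Fintype.sum_prod_type, Finset.sum_mul_sum]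
    exact Finset.sum_congr rfl fun _ _ => Finset.sum_congr rfl fun _ _ => by ring
  have hχ' : chiSqDiv ((piChannel (n + 1) W).mulVec S)
      ((piChannel (n + 1) W).mulVec (piPmf (n + 1) P)) =
      chiSqDiv (W.mulVec R) (W.mulVec P) := by
    rw [hWS, piChannel_mulVec, piPmf_succ,
      chiSqDiv_comp_equiv _ fun y => mul_pos (hQ _) (piPmf_pos hQ n _),
      chiSqDiv_prod_right hQ (piPmf_pos hQ n) hQn]
  have hSmem : S ∈ stdSimplex ℝ (Fin (n + 1) → α) := by
    refine ⟨fun x => mul_nonneg (hR.1.1 _) (piPmf_pos hP n _).le, ?_⟩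
    rw [hS]
    simp only [Function.comp_apply]
    rw [Equiv.sum_comp _ fun x : α × (Fin n → α) => R x.1 * piPmf n P x.2,
      Fintype.sum_prod_type]
    simp_rw [← Finset.mul_sum, hPn, mul_one]
    exact hR.1.2
  refine le_iSup₂_of_le (f := fun R _ => chiSqDiv ((piChannel (n + 1) W).mulVec R)
    ((piChannel (n + 1) W).mulVec (piPmf (n + 1) P)) / chiSqDiv R (piPmf (n + 1) P))
    S ⟨hSmem, ?_, ?_⟩ ?_
  · rw [hχ]; exact hR.2.1
  · rw [hχ]; exact hR.2.2
  · rw [hχ, hχ']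

variable [Nontrivial α]

theorem etaKL_pi_le {P : α → ℝ} {W : Matrix β α ℝ} (hP : ∀ x, 0 < P x)
    (hP1 : ∑ x, P x = 1) (hQ : ∀ y, 0 < W.mulVec P y) (hW : ∀ y x, 0 ≤ W y x)
    (hs : ∀ x, ∑ y, W y x = 1) (n : ℕ) :
    etaKL (piPmf n P) (piChannel n W) ≤ 2 * etaChiSq (piPmf n P) (piChannel n W) /
      ENNReal.ofReal (phi (maxBalance P) * minProb P) := by
  have hQn : ∀ y, 0 < (piChannel n W).mulVec (piPmf n P) y := by
    rw [piChannel_mulVec]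
    exact piPmf_pos hQ n
  have hbound : ∀ c : ℝ, 0 ≤ c → Contracts (piPmf n P) (piChannel n W) c →
      etaKL (piPmf n P) (piChannel n W) ≤ ENNReal.ofReal c := fun c hc h =>
    etaKL_le_of_contracts hc h (piPmf_pos hP n) hQn (piChannel_col_sum hs n)
  -- With no letters there is no coordinate to perturb, but the KL coefficient is then zero.
  rcases n with _ | n
  · have := hbound 0 le_rfl (contracts_piPmf_zero P W 0)
    rw [ENNReal.ofReal_zero] at this
    exact this.trans zero_le
  have hmono := etaChiSq_le_pi_succ hP hP1 hQ hs n
  have hd := phi_mul_minProb_pos hP hP1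
  -- An infinite coefficient makes the right side infinite; otherwise the one-letter coefficient is
  -- finite and gives a real constant.
  rcases eq_or_ne (etaChiSq (piPmf (n + 1) P) (piChannel (n + 1) W)) ⊤ with htop | hne
  · rw [htop, ENNReal.mul_top two_ne_zero, ENNReal.top_div_of_ne_top ENNReal.ofReal_ne_top]
    exact le_top
  have hfin : etaChiSq P W ≠ ⊤ := ne_top_of_le_ne_top hne hmono
  have hc : 0 ≤ 2 * (etaChiSq P W).toReal / (phi (maxBalance P) * minProb P) :=
    div_nonneg (mul_nonneg two_pos.le ENNReal.toReal_nonneg) hd.le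
  refine (hbound _ hc ((contracts_of_chiSq ENNReal.toReal_nonneg hP hP1 hQ hW hs fun R hR =>
    chiSq_le_of_etaChiSq hP hQ hfin hR).pi hc hP hQ hW hs (n + 1))).trans ?_
  rw [ENNReal.ofReal_div_of_pos hd, ENNReal.ofReal_mul two_pos.le, ENNReal.ofReal_toReal hfin,
    ENNReal.ofReal_ofNat]
  gcongr

end Tensor

/-! ### The joint law of the i.i.d. pairs -/

section Joint

variable {α β : Type*}

theorem fstMarginal_pi [Fintype β] (n : ℕ) (P : α × β → ℝ) :
    fstMarginal (fun z : (Fin n → α) × (Fin n → β) => ∏ i, P (z.1 i, z.2 i)) =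
      piPmf n (fstMarginal P) := by
  classical
  ext x
  simp only [fstMarginal, piPmf]
  rw [Finset.prod_univ_sum, Fintype.piFinset_univ]

theorem channel_pi [Fintype β] (n : ℕ) (P : α × β → ℝ) :
    channel (fun z : (Fin n → α) × (Fin n → β) => ∏ i, P (z.1 i, z.2 i)) =
      piChannel n (channel P) := by
  ext y x
  rw [channel, Matrix.of_apply, fstMarginal_pi]
  simp [piChannel, channel, piPmf, Finset.prod_div_distrib]

theorem channel_col_sum [Fintype β] {P : α × β → ℝ} (hP : ∀ x, 0 < fstMarginal P x) (x : α) :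
    ∑ y, channel P y x = 1 := by
  simp only [channel, Matrix.of_apply]
  rw [← Finset.sum_div]
  exact div_self (hP x).ne'

theorem channel_mulVec [Fintype α] [Fintype β] {P : α × β → ℝ} (hP : ∀ x, 0 < fstMarginal P x) :
    (channel P).mulVec (fstMarginal P) = sndMarginal P := by
  ext y
  simp only [channel, Matrix.mulVec, dotProduct, Matrix.of_apply, sndMarginal]
  exact Finset.sum_congr rfl fun x _ => div_mul_cancel₀ _ (hP x).ne'

open MeasureTheory ProbabilityTheory in
theorem pmfOf_iid [MeasurableSpace α] [MeasurableSingletonClass α] [MeasurableSpace β]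
    [MeasurableSingletonClass β] {Ω : Type*} [MeasurableSpace Ω] {μ : Measure Ω}
    {n : ℕ} {X : Fin n → Ω → α} {Y : Fin n → Ω → β} {P : α × β → ℝ}
    (hindep : iIndepFun (fun i ω => (X i ω, Y i ω)) μ)
    (hlaw : ∀ i, pmfOf μ (fun ω => (X i ω, Y i ω)) = P) :
    pmfOf μ (fun ω => (fun i => X i ω, fun i => Y i ω)) =
      fun z : (Fin n → α) × (Fin n → β) => ∏ i, P (z.1 i, z.2 i) := by
  ext z
  have h := hindep.measure_inter_preimage_eq_mul Finset.univ
    (sets := fun i => {(z.1 i, z.2 i)}) fun i _ => measurableSet_singleton _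
  have hset : (fun ω => (fun i => X i ω, fun i => Y i ω)) ⁻¹' {z} =
      ⋂ i ∈ Finset.univ, (fun ω => (X i ω, Y i ω)) ⁻¹' {(z.1 i, z.2 i)} := by
    ext ω
    simp [Prod.ext_iff, funext_iff, forall_and]
  rw [pmfOf, measureReal_def, hset, h, ENNReal.toReal_prod]
  exact Finset.prod_congr rfl fun i _ => congrFun (hlaw i) (z.1 i, z.2 i)

end Joint

end SDPI
theorem corollary2
    {𝓧 𝓨 : Type*} [Fintype 𝓧] [Fintype 𝓨] [Nontrivial 𝓧] [Nontrivial 𝓨]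
    [MeasurableSpace 𝓧] [MeasurableSingletonClass 𝓧]
    [MeasurableSpace 𝓨] [MeasurableSingletonClass 𝓨]
    (P : 𝓧 × 𝓨 → ℝ) (hP : P ∈ stdSimplex ℝ (𝓧 × 𝓨))
    (hPX : ∀ x, 0 < SDPI.fstMarginal P x) (hPY : ∀ y, 0 < SDPI.sndMarginal P y)
    {Ω : Type*} [MeasurableSpace Ω] (μ : MeasureTheory.Measure Ω)
    [MeasureTheory.IsProbabilityMeasure μ]
    (n : ℕ) (X : Fin n → Ω → 𝓧) (Y : Fin n → Ω → 𝓨)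
    (hX : ∀ i, Measurable (X i)) (hY : ∀ i, Measurable (Y i))
    (hindep : ProbabilityTheory.iIndepFun (fun i ω => (X i ω, Y i ω)) μ)
    (hlaw : ∀ i, SDPI.pmfOf μ (fun ω => (X i ω, Y i ω)) = P)
    (Q : (Fin n → 𝓧) × (Fin n → 𝓨) → ℝ)
    (hQ : Q = SDPI.pmfOf μ (fun ω => (fun i => X i ω, fun i => Y i ω))) :
    SDPI.etaChiSq (SDPI.fstMarginal Q) (SDPI.channel Q) ≤
        SDPI.etaKL (SDPI.fstMarginal Q) (SDPI.channel Q) ∧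
      SDPI.etaKL (SDPI.fstMarginal Q) (SDPI.channel Q) ≤
        2 * SDPI.etaChiSq (SDPI.fstMarginal Q) (SDPI.channel Q) /
          ENNReal.ofReal
            (SDPI.phi (SDPI.maxBalance (SDPI.fstMarginal P)) *
              SDPI.minProb (SDPI.fstMarginal P)) := by
  have hW : ∀ y x, 0 ≤ SDPI.channel P y x := fun y x => div_nonneg (hP.1 _) (hPX x).le
  have hs := SDPI.channel_col_sum hPX
  have hQ' : ∀ y, 0 < (SDPI.channel P).mulVec (SDPI.fstMarginal P) y := by
    rwa [SDPI.channel_mulVec hPX]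
  have hP1 : ∑ x, SDPI.fstMarginal P x = 1 := by
    rw [← hP.2, Fintype.sum_prod_type]
    rfl
  rw [hQ, SDPI.pmfOf_iid hindep hlaw, SDPI.fstMarginal_pi, SDPI.channel_pi]
  refine ⟨SDPI.etaChiSq_le_etaKL (SDPI.piPmf_pos hPX n) ?_ ?_ (SDPI.piChannel_col_sum hs n),
    SDPI.etaKL_pi_le hPX hP1 hQ' hW hs n⟩
  · rw [SDPI.sum_piPmf, hP1, one_pow]
  · rw [SDPI.piChannel_mulVec]
    exact SDPI.piPmf_pos hQ' n
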